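/- Let $L=[\gamma,\delta]$ with $\gamma<\delta$ real, regarded as a subset of $\mathbb{R}\subset\mathbb{C}$, and let $k\in\{0,1,2,\dots\}\cup\{\infty\}$. Let $C^k(L)$ be the space of $k$ times continuously differentiable functions $u:L\to\mathbb{C}$ (one-sided derivatives at the end points; infinitely differentiable functions if $k=\infty$) with the topology defined by the seminorms $\sup_{x\in L}|u^{(l)}(x)|$, $l\in\mathbb{N}$, $0\le l\le k$. Write $D(z_0,r)$ for the open disc of centre $z_0$ and radius $r$ in $\mathbb{C}$. Let $U_2(L,k)$ be the set of all $u\in C^k(L)$ for which there are no $z_0\in L$, $r>0$ and continuous function $\lambda:L\cup\Omega\to\mathbb{C}$, where $\Omega=D(z_0,r)\cap\{\operatorname{Im} z>0\}$, such that $\lambda$ is holomorphic on $\Omega$ and $\lambda=u$ on $D(z_0,r)\cap L$. Let $U_3(L,k)$ be defined in the same way with $\{\operatorname{Im} z<0\}$ in place of $\{\operatorname{Im} z>0\}$. Let $U_4(L,k)$ be the set of all $u\in C^k(L)$ that have neither an extension of the first kind nor one of the second kind, at any $z_0\in L$ and for any $r>0$. Let $U_5(L,k)$ be the set of all $u\in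 C^k(L)$ for which there are no $z_0\in L$, $r>0$ and holomorphic $f:D(z_0,r)\to\mathbb{C}$ with $f=u$ on $D(z_0,r)\cap L$. Then each of the sets $U_2(L,k)$, $U_3(L,k)$, $U_4(L,k)$ and $U_5(L,k)$ is dense and $G_\delta$ in $C^k(L)$. In particular, the set of all $u\in C^\infty([0,1])$ that are real analytic at no point of $[0,1]$ is a dense $G_\delta$ subset of $C^\infty([0,1])$; here $u$ is real analytic at $x_0\in[0,1]$ if there are $\varepsilon>0$ and a power series $\sum_{n\ge 0} a_n(x-x_0)^n$ with complex coefficients that converges to $u(x)$ for all $x\in[0,1]$ with $|x-x_0|<\varepsilon$. -/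

import Mathlib

open Set Metric Topology

noncomputable section

/-- The extension by zero to `ℝ` of a function on `[γ, δ]`. It only serves to speak of
one-sided notions relative to `[γ, δ]`, which do not see the values outside `[γ, δ]`. -/
def extendZero {γ δ : ℝ} (u : Icc γ δ → ℂ) : ℝ → ℂ :=
  Function.extend Subtype.val u 0

theorem extendZero_coe {γ δ : ℝ} (u : Icc γ δ → ℂ) (x : Icc γ δ) :
    extendZero u (x : ℝ) = u x :=
  Subtype.val_injective.extend_apply u 0 x

theorem extendZero_add {γ δ : ℝ} (u v : Icc γ δ → ℂ) :
    extendZero (u + v) = extendZero u + extendZero v := by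
  have h := Function.extend_add (Subtype.val : Icc γ δ → ℝ) u v (0 : ℝ → ℂ) 0
  rw [add_zero] at h
  exact h

theorem extendZero_smul {γ δ : ℝ} (c : ℂ) (u : Icc γ δ → ℂ) :
    extendZero (c • u) = c • extendZero u := by
  have h := Function.extend_smul c (Subtype.val : Icc γ δ → ℝ) u (0 : ℝ → ℂ)
  rw [smul_zero] at h
  exact h

/-- The complex-valued functions on `[γ, δ]` that are `k` times continuously differentiable
(one-sided derivatives at the end points), as a space of functions without topology. -/
def ckSubmodule (γ δ : ℝ) (k : ℕ∞) : Submodule ℂ (Icc γ δ → ℂ) where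
  carrier := {u | ContDiffOn ℝ k (extendZero u) (Icc γ δ)}
  add_mem' {u v} hu hv := by
    simp only [mem_ofPred_eq] at hu hv ⊢
    rw [extendZero_add]
    exact hu.add hv
  zero_mem' := by
    have h : extendZero (0 : Icc γ δ → ℂ) = 0 := by
      simpa using extendZero_smul (0 : ℂ) (0 : Icc γ δ → ℂ)
    simp only [mem_ofPred_eq]
    rw [h]
    exact contDiffOn_const
  smul_mem' c u hu := by
    simp only [mem_ofPred_eq] at hu ⊢
    rw [extendZero_smul]
    exact hu.const_smul c

/-- The space `C^k([γ, δ])`, `k = 0, 1, 2, …, ∞`, of complex-valued functions. It is a type of its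
own, so that it does not carry the topology of pointwise convergence. -/
def CkSpace {γ δ : ℝ} (_h : γ < δ) (k : ℕ∞) : Type :=
  ckSubmodule γ δ k

namespace CkSpace

variable {γ δ : ℝ} {h : γ < δ} {k : ℕ∞}

instance : AddCommGroup (CkSpace h k) := inferInstanceAs (AddCommGroup (ckSubmodule γ δ k))

instance : Module ℂ (CkSpace h k) := inferInstanceAs (Module ℂ (ckSubmodule γ δ k))

/-- The function on `[γ, δ]` underlying an element of `C^k([γ, δ])`. -/
def toFun (u : CkSpace h k) : Icc γ δ → ℂ := Subtype.val u

instance : CoeFun (CkSpace h k) (fun _ => Icc γ δ → ℂ) := ⟨toFun⟩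

theorem contDiffOn (u : CkSpace h k) : ContDiffOn ℝ k (extendZero u) (Icc γ δ) :=
  Subtype.property u

/-- The `l`-th derivative, `l ≤ k`, as a linear map from `C^k([γ, δ])` to the Banach space of
continuous functions on `[γ, δ]` with the supremum norm. -/
def derivMap (h : γ < δ) (k : ℕ∞) (l : ℕ) (hl : (l : ℕ∞) ≤ k) :
    CkSpace h k →ₗ[ℂ] C(Icc γ δ, ℂ) where
  toFun u :=
    { toFun := fun x => iteratedDerivWithin l (extendZero u) (Icc γ δ) x
      continuous_toFun := by
        have hc := u.contDiffOn.continuousOn_iteratedDerivWithin (m := l)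
          (by exact_mod_cast hl) (uniqueDiffOn_Icc h)
        exact hc.comp_continuous continuous_subtype_val (fun x => x.2) }
  map_add' u v := by
    ext x
    have e : extendZero (u + v : CkSpace h k) = extendZero u + extendZero v :=
      extendZero_add _ _
    change iteratedDerivWithin l (extendZero (u + v : CkSpace h k)) (Icc γ δ) x =
      iteratedDerivWithin l (extendZero u) (Icc γ δ) x +
        iteratedDerivWithin l (extendZero v) (Icc γ δ) x
    rw [e]
    exact iteratedDerivWithin_add x.2 (uniqueDiffOn_Icc h)
      ((u.contDiffOn.of_le (by exact_mod_cast hl)) x x.2)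
      ((v.contDiffOn.of_le (by exact_mod_cast hl)) x x.2)
  map_smul' c u := by
    ext x
    have e : extendZero (c • u : CkSpace h k) = c • extendZero u := extendZero_smul _ _
    change iteratedDerivWithin l (extendZero (c • u : CkSpace h k)) (Icc γ δ) x =
      c • iteratedDerivWithin l (extendZero u) (Icc γ δ) x
    rw [e]
    exact iteratedDerivWithin_const_smul x.2 (uniqueDiffOn_Icc h) c
      ((u.contDiffOn.of_le (by exact_mod_cast hl)) x x.2)

/-- The seminorms `u ↦ sup_{x ∈ [γ, δ]} |u^{(l)}(x)|`, `l ≤ k`. -/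
def seminorms (h : γ < δ) (k : ℕ∞) :
    SeminormFamily ℂ (CkSpace h k) {l : ℕ // (l : ℕ∞) ≤ k} :=
  fun l => (normSeminorm ℂ C(Icc γ δ, ℂ)).comp (derivMap h k l.1 l.2)

theorem seminorms_apply (l : {l : ℕ // (l : ℕ∞) ≤ k}) (u : CkSpace h k) :
    seminorms h k l u
      = ⨆ x : Icc γ δ, ‖iteratedDerivWithin (l : ℕ) (extendZero u) (Icc γ δ) x‖ :=
  ContinuousMap.norm_eq_iSup_norm (derivMap h k l.1 l.2 u)

instance : Nonempty {l : ℕ // (l : ℕ∞) ≤ k} := ⟨⟨0, by simp⟩⟩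

/-- The topology of `C^k([γ, δ])` defined by the seminorms `sup |u^{(l)}|`, `l ≤ k`. -/
instance : TopologicalSpace (CkSpace h k) := (seminorms h k).moduleFilterBasis.topology

theorem withSeminorms (h : γ < δ) (k : ℕ∞) : WithSeminorms (seminorms h k) := ⟨rfl⟩

end CkSpace

/-- The compact interval `[γ, δ]` as a subset of the complex plane. -/
def segmentC (γ δ : ℝ) : Set ℂ := (fun x : ℝ => (x : ℂ)) '' Icc γ δ

/-- The upper half disc `D(x₀, r) ∩ {Im z > 0}`. -/
def upperHalfDisc (x₀ r : ℝ) : Set ℂ := ball (x₀ : ℂ) r ∩ {z | 0 < z.im}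

/-- The lower half disc `D(x₀, r) ∩ {Im z < 0}`. -/
def lowerHalfDisc (x₀ r : ℝ) : Set ℂ := ball (x₀ : ℂ) r ∩ {z | z.im < 0}

section Classes

variable {γ δ : ℝ} {h : γ < δ} {k : ℕ∞}

/-- `u` extends to the upper half disc of centre `x₀` and radius `r`: there is a function that is
continuous on the union of the interval and the half disc, holomorphic on the half disc, and equal
to `u` on the part of the interval inside the disc. -/
def ExtendsAbove (u : CkSpace h k) (x₀ r : ℝ) : Prop :=
  ∃ f : ℂ → ℂ, ContinuousOn f (segmentC γ δ ∪ upperHalfDisc x₀ r) ∧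
    DifferentiableOn ℂ f (upperHalfDisc x₀ r) ∧
    ∀ x : Icc γ δ, ((x : ℝ) : ℂ) ∈ ball (x₀ : ℂ) r → f ((x : ℝ) : ℂ) = u x

/-- The same as `ExtendsAbove`, for the lower half disc. -/
def ExtendsBelow (u : CkSpace h k) (x₀ r : ℝ) : Prop :=
  ∃ f : ℂ → ℂ, ContinuousOn f (segmentC γ δ ∪ lowerHalfDisc x₀ r) ∧
    DifferentiableOn ℂ f (lowerHalfDisc x₀ r) ∧
    ∀ x : Icc γ δ, ((x : ℝ) : ℂ) ∈ ball (x₀ : ℂ) r → f ((x : ℝ) : ℂ) = u x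

/-- `u` coincides on the part of the interval inside the disc of centre `x₀` and radius `r` with
a function that is holomorphic on this disc. -/
def ExtendsToDisc (u : CkSpace h k) (x₀ r : ℝ) : Prop :=
  ∃ f : ℂ → ℂ, DifferentiableOn ℂ f (ball (x₀ : ℂ) r) ∧
    ∀ x : Icc γ δ, ((x : ℝ) : ℂ) ∈ ball (x₀ : ℂ) r → f ((x : ℝ) : ℂ) = u x

/-- The class `U₂([γ, δ], k)`. -/
def classU2 (h : γ < δ) (k : ℕ∞) : Set (CkSpace h k) :=
  {u | ¬ ∃ x₀ ∈ Icc γ δ, ∃ r > 0, ExtendsAbove u x₀ r}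

/-- The class `U₃([γ, δ], k)`. -/
def classU3 (h : γ < δ) (k : ℕ∞) : Set (CkSpace h k) :=
  {u | ¬ ∃ x₀ ∈ Icc γ δ, ∃ r > 0, ExtendsBelow u x₀ r}

/-- The class `U₄([γ, δ], k)`: neither an extension above nor an extension below exists. -/
def classU4 (h : γ < δ) (k : ℕ∞) : Set (CkSpace h k) :=
  {u | (¬ ∃ x₀ ∈ Icc γ δ, ∃ r > 0, ExtendsAbove u x₀ r) ∧
    ¬ ∃ x₀ ∈ Icc γ δ, ∃ r > 0, ExtendsBelow u x₀ r}

/-- The class `U₅([γ, δ], k)`. -/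
def classU5 (h : γ < δ) (k : ℕ∞) : Set (CkSpace h k) :=
  {u | ¬ ∃ x₀ ∈ Icc γ δ, ∃ r > 0, ExtendsToDisc u x₀ r}

/-- The functions in `C^k([γ, δ])` that are real analytic at no point of `[γ, δ]`: around no
`x₀ ∈ [γ, δ]` they are, on `[γ, δ]`, the sum of a convergent power series in `x - x₀`. -/
def nowhereAnalytic (h : γ < δ) (k : ℕ∞) : Set (CkSpace h k) :=
  {u | ∀ x₀ ∈ Icc γ δ, ¬ AnalyticWithinAt ℝ (extendZero u) (Icc γ δ) x₀}

end Classes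

end

open Filter ComplexConjugate

noncomputable section

/-! Write `L` for `[γ, δ]`. Every extension above restricts to a closed half disc whose diameter is
a rational interval inside `L`, where it is bounded by some natural number `M`. So the complement of
`U₂` is a countable union of sets `A` of functions with an extension bounded by `M` on a fixed half
disc.

Such a set `A` need not be visibly closed, but a uniform limit on `L` of elements of `A` still has
an extension to the half disc of one eighth the radius (`closure_boundedUpperExtendable_subset`).
This rests on a two-constants estimate: a bounded holomorphic function that is small on the diameter
is small near the centre, so the extensions converge there. Hence the union of the `A` equals the
union of their closures, and `U₂` is `Gδ`, first in `C(L)` and then in `C^k` by continuity of the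
inclusion.

For density, the preimage of each closure in `C^k` lies in the linear subspace of functions
extendable to the smaller half disc. This subspace is proper, since it omits a smooth function that
vanishes exactly on one side of the centre, so it has empty interior. Baire's theorem applies
because `C^k` embeds through its derivatives as a closed subspace of a countable product of Banach
spaces.

Conjugation turns `U₃` into `U₂`, and `U₄` is the intersection of the two. The set `U₅` contains
`U₂`, so it is dense; it is `Gδ` by the same argument on full discs. Nowhere analytic functions are
exactly those in `U₅`. -/

/-! ### Half discs centred on the real line -/

/-- The closed upper half disc of centre `x₀` and radius `r`. -/
def closedUpperHalfDisc (x₀ r : ℝ) : Set ℂ := closedBall (x₀ : ℂ) r ∩ {z | 0 ≤ z.im}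

theorem isClosed_closedUpperHalfDisc (x₀ r : ℝ) : IsClosed (closedUpperHalfDisc x₀ r) :=
  isClosed_closedBall.inter (isClosed_le continuous_const Complex.continuous_im)

theorem isCompact_closedUpperHalfDisc (x₀ r : ℝ) : IsCompact (closedUpperHalfDisc x₀ r) :=
  (isCompact_closedBall _ _).inter_right (isClosed_le continuous_const Complex.continuous_im)

theorem isOpen_upperHalfDisc (x₀ r : ℝ) : IsOpen (upperHalfDisc x₀ r) :=
  isOpen_ball.inter (isOpen_lt continuous_const Complex.continuous_im)

theorem upperHalfDisc_subset_closed (x₀ r : ℝ) :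
    upperHalfDisc x₀ r ⊆ closedUpperHalfDisc x₀ r :=
  inter_subset_inter ball_subset_closedBall fun z (hz : 0 < z.im) => hz.le

theorem closedUpperHalfDisc_mono {x₀ r y s : ℝ} (h : |x₀ - y| + r ≤ s) :
    closedUpperHalfDisc x₀ r ⊆ closedUpperHalfDisc y s := by
  refine inter_subset_inter_left _ (closedBall_subset_closedBall' ?_)
  rw [Complex.dist_of_im_eq (by simp), Complex.ofReal_re, Complex.ofReal_re, Real.dist_eq]
  linarith

theorem upperHalfDisc_mono {x₀ r y s : ℝ} (h : |x₀ - y| + r ≤ s) :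
    upperHalfDisc x₀ r ⊆ upperHalfDisc y s := by
  refine inter_subset_inter_left _ (ball_subset_ball' ?_)
  rw [Complex.dist_of_im_eq (by simp), Complex.ofReal_re, Complex.ofReal_re, Real.dist_eq]
  linarith

theorem ofReal_mem_closedBall {x x₀ r : ℝ} :
    (x : ℂ) ∈ closedBall (x₀ : ℂ) r ↔ |x - x₀| ≤ r := by
  rw [mem_closedBall, Complex.dist_of_im_eq (by simp), Complex.ofReal_re, Complex.ofReal_re,
    Real.dist_eq]

theorem ofReal_mem_ball {x x₀ r : ℝ} : (x : ℂ) ∈ ball (x₀ : ℂ) r ↔ |x - x₀| < r := by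
  rw [mem_ball, Complex.dist_of_im_eq (by simp), Complex.ofReal_re, Complex.ofReal_re,
    Real.dist_eq]

theorem ofReal_mem_closedUpperHalfDisc {x x₀ r : ℝ} :
    (x : ℂ) ∈ closedUpperHalfDisc x₀ r ↔ |x - x₀| ≤ r := by
  simp only [closedUpperHalfDisc, mem_inter_iff, ofReal_mem_closedBall, mem_ofPred_eq,
    Complex.ofReal_im, le_refl, and_true]

theorem sq_add_sq_le_of_mem_closedBall {x₀ r : ℝ} {z : ℂ}
    (hz : z ∈ closedBall (x₀ : ℂ) r) : (z.re - x₀) ^ 2 + z.im ^ 2 ≤ r ^ 2 := by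
  rw [mem_closedBall, Complex.dist_eq] at hz
  have h1 : ‖z - x₀‖ ^ 2 ≤ r ^ 2 := by gcongr
  rw [← Complex.normSq_eq_norm_sq, Complex.normSq_apply] at h1
  simp at h1
  nlinarith

/-! ### Holomorphic functions controlled by their values on the diameter -/

/-- A two-constants estimate on a half disc: a function that is small on the diameter is small
near the centre. -/
theorem norm_le_of_norm_le_on_diameter {g : ℂ → ℂ} {x₀ r M ε : ℝ} (hr : 0 < r)
    (hc : ContinuousOn g (closedUpperHalfDisc x₀ r))
    (hd : DifferentiableOn ℂ g (upperHalfDisc x₀ r))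
    (hM : ∀ z ∈ closedUpperHalfDisc x₀ r, ‖g z‖ ≤ M)
    (hε : ∀ x : ℝ, |x - x₀| ≤ r → ‖g x‖ ≤ ε) {N : ℝ} (hN : 0 ≤ N) {z : ℂ}
    (hz : z ∈ closedUpperHalfDisc x₀ (r / 8)) :
    ‖g z‖ ≤ Real.exp (N * (r ^ 2 / 2)) * ε + Real.exp (-(N * (r ^ 2 / 2))) * M := by
  have hε0 : 0 ≤ ε := (norm_nonneg _).trans (hε x₀ (by simpa using hr.le))
  have hM0 : 0 ≤ M := (norm_nonneg _).trans
    (hM x₀ (ofReal_mem_closedUpperHalfDisc.2 (by simpa using hr.le)))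
  have hzr := sq_add_sq_le_of_mem_closedBall hz.1
  have hz0 : 0 ≤ z.im := hz.2
  rcases hz0.eq_or_lt with h0 | h0
  · have hzx : z = (z.re : ℂ) := Complex.ext rfl h0.symm
    have h1 : ‖g z‖ ≤ ε := by
      rw [hzx]
      apply hε
      have : |z.re - x₀| ≤ r / 8 := ofReal_mem_closedBall.1 (by rw [← hzx]; exact hz.1)
      linarith
    have h2 : (1 : ℝ) ≤ Real.exp (N * (r ^ 2 / 2)) := Real.one_le_exp (by positivity)
    nlinarith [mul_nonneg (Real.exp_pos (-(N * (r ^ 2 / 2)))).le hM0]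
  -- With `w - x₀ = a + ib`, the real part of the exponent is `N (b² - a² - 2rb)`. It is at most `0`
  -- on the diameter and at most `-N r²` on the arc, but at least `-N r² / 2` when `|w - x₀| ≤ r /
  -- 8`. The maximum principle for `F` gives the estimate.
  set F : ℂ → ℂ := fun w => Complex.exp (N * (-(w - x₀) ^ 2 + 2 * Complex.I * r * (w - x₀))) * g w
    with hF
  have hnorm : ∀ w, ‖F w‖
      = Real.exp (N * (w.im ^ 2 - (w.re - x₀) ^ 2 - 2 * r * w.im)) * ‖g w‖ := by
    intro w
    simp only [hF, norm_mul, Complex.norm_exp]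
    congr 3
    simp [pow_two]
    ring_nf
    simp
  have hexp : Differentiable ℂ fun w : ℂ =>
      Complex.exp (N * (-(w - x₀) ^ 2 + 2 * Complex.I * r * (w - x₀))) := by fun_prop
  have hcl : closure (upperHalfDisc x₀ r) ⊆ closedUpperHalfDisc x₀ r :=
    closure_minimal (upperHalfDisc_subset_closed x₀ r) (isClosed_closedUpperHalfDisc x₀ r)
  have hFd : DiffContOnCl ℂ F (upperHalfDisc x₀ r) :=
    ⟨hexp.differentiableOn.mul hd, hexp.continuous.continuousOn.mul (hc.mono hcl)⟩
  have hzU : z ∈ upperHalfDisc x₀ r :=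
    ⟨closedBall_subset_ball (by linarith) hz.1, h0⟩
  have hb : ‖F z‖ ≤ ε + Real.exp (-(N * r ^ 2)) * M := by
    refine Complex.norm_le_of_forall_mem_frontier_norm_le
      (isBounded_ball.subset inter_subset_left) hFd ?_ (subset_closure hzU)
    intro w hw
    have hwK := hcl hw.1
    have hwU : w ∉ upperHalfDisc x₀ r :=
      (isOpen_upperHalfDisc x₀ r).interior_eq ▸ hw.2
    have hw0 : 0 ≤ w.im := hwK.2
    rw [hnorm]
    rcases hw0.eq_or_lt with h1 | h1
    · have hwx : w = (w.re : ℂ) := Complex.ext rfl h1.symm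
      have h2 : ‖g w‖ ≤ ε := by
        rw [hwx]
        apply hε
        exact ofReal_mem_closedBall.1 (by rw [← hwx]; exact hwK.1)
      have h3 : Real.exp (N * (w.im ^ 2 - (w.re - x₀) ^ 2 - 2 * r * w.im)) ≤ 1 := by
        rw [Real.exp_le_one_iff, ← h1]
        nlinarith [mul_nonneg hN (sq_nonneg (w.re - x₀))]
      nlinarith [norm_nonneg (g w), mul_nonneg (Real.exp_pos (-(N * r ^ 2))).le hM0]
    · have hwr : r ≤ ‖w - x₀‖ := by
        by_contra! hlt
        exact hwU ⟨by rwa [mem_ball, Complex.dist_eq], h1⟩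
      have h2 : r ^ 2 ≤ ‖w - x₀‖ ^ 2 := by gcongr
      rw [← Complex.normSq_eq_norm_sq, Complex.normSq_apply] at h2
      simp at h2
      have h3 := sq_add_sq_le_of_mem_closedBall hwK.1
      have h4 : w.im ≤ r := by nlinarith [sq_nonneg (w.re - x₀)]
      have h5 : Real.exp (N * (w.im ^ 2 - (w.re - x₀) ^ 2 - 2 * r * w.im))
          ≤ Real.exp (-(N * r ^ 2)) := by
        rw [Real.exp_le_exp, ← mul_neg]
        apply mul_le_mul_of_nonneg_left _ hN
        nlinarith
      calc _ ≤ Real.exp (-(N * r ^ 2)) * M :=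
            mul_le_mul h5 (hM w hwK) (norm_nonneg _) (Real.exp_pos _).le
        _ ≤ _ := by linarith
  rw [hnorm] at hb
  have him : z.im ≤ r / 8 := by nlinarith [sq_nonneg (z.re - x₀)]
  have h6 : Real.exp (-(N * (r ^ 2 / 2)))
      ≤ Real.exp (N * (z.im ^ 2 - (z.re - x₀) ^ 2 - 2 * r * z.im)) := by
    rw [Real.exp_le_exp, ← mul_neg]
    apply mul_le_mul_of_nonneg_left _ hN
    nlinarith [sq_nonneg z.im]
  have h7 : Real.exp (-(N * (r ^ 2 / 2))) * ‖g z‖ ≤ ε + Real.exp (-(N * r ^ 2)) * M :=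
    (mul_le_mul_of_nonneg_right h6 (norm_nonneg _)).trans hb
  have h8 := mul_le_mul_of_nonneg_left h7 (Real.exp_pos (N * (r ^ 2 / 2))).le
  rw [← mul_assoc, ← Real.exp_add, add_neg_cancel, Real.exp_zero, one_mul, mul_add, ← mul_assoc,
    ← Real.exp_add] at h8
  convert! h8 using 4
  ring

/-- Qualitative form of `norm_le_of_norm_le_on_diameter`. -/
theorem exists_pos_norm_le_of_norm_le_on_diameter {r η : ℝ} (M : ℝ) (hr : 0 < r) (hη : 0 < η) :
    ∃ ε > 0, ∀ (x₀ : ℝ) (g : ℂ → ℂ), ContinuousOn g (closedUpperHalfDisc x₀ r) →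
      DifferentiableOn ℂ g (upperHalfDisc x₀ r) →
      (∀ z ∈ closedUpperHalfDisc x₀ r, ‖g z‖ ≤ M) →
      (∀ x : ℝ, |x - x₀| ≤ r → ‖g x‖ ≤ ε) →
      ∀ z ∈ closedUpperHalfDisc x₀ (r / 8), ‖g z‖ ≤ η := by
  have h1 : Tendsto (fun N : ℝ => Real.exp (-(N * (r ^ 2 / 2))) * M) atTop (𝓝 (0 * M)) :=
    ((Real.tendsto_exp_neg_atTop_nhds_zero).comp
      (tendsto_id.atTop_mul_const (by positivity))).mul_const M
  rw [zero_mul] at h1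
  obtain ⟨N, hN, hN0⟩ := ((h1.eventually_le_const (half_pos hη)).and (eventually_ge_atTop 0)).exists
  -- `N` was chosen to make the term with `M` at most `η / 2`; this `ε` makes the other term equal
  -- to `η / 2`. Neither depends on `x₀` or `g`.
  refine ⟨η / 2 / Real.exp (N * (r ^ 2 / 2)), by positivity, fun x₀ g hc hd hM hε z hz => ?_⟩
  have h2 := norm_le_of_norm_le_on_diameter hr hc hd hM hε hN0 hz
  rw [mul_div_cancel₀ _ (Real.exp_pos _).ne'] at h2
  linarith

/-- A holomorphic function on a half disc that vanishes on the diameter is zero. -/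
theorem eqOn_zero_of_eq_zero_on_diameter {g : ℂ → ℂ} {x₀ r y s : ℝ} (hs : 0 < s)
    (hsub : |y - x₀| + s ≤ r)
    (hc : ContinuousOn g (closedUpperHalfDisc x₀ r))
    (hd : DifferentiableOn ℂ g (upperHalfDisc x₀ r))
    (h0 : ∀ x : ℝ, |x - y| ≤ s → g x = 0) : EqOn g 0 (upperHalfDisc x₀ r) := by
  obtain ⟨M, hM⟩ := (isCompact_closedUpperHalfDisc y s).exists_bound_of_continuousOn
    (hc.mono (closedUpperHalfDisc_mono hsub))
  -- On the diameter of the smaller half disc `g` is zero, hence below every `ε`, so near `y` it is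
  -- below every `η`. The identity theorem then spreads the zero from an interior point.
  have hz : ∀ z ∈ closedUpperHalfDisc y (s / 8), g z = 0 := by
    intro z hz
    rw [← norm_le_zero_iff]
    refine le_of_forall_pos_le_add fun η hη => ?_
    obtain ⟨ε, hε, H⟩ := exists_pos_norm_le_of_norm_le_on_diameter M hs hη
    rw [zero_add]
    refine H y g (hc.mono (closedUpperHalfDisc_mono hsub)) (hd.mono (upperHalfDisc_mono hsub)) hM
      (fun x hx => ?_) z hz
    rw [h0 x hx, norm_zero]
    exact hε.le
  have hp : (y + (s / 16 : ℝ) * Complex.I : ℂ) ∈ upperHalfDisc y (s / 8) := by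
    refine ⟨?_, ?_⟩
    · rw [mem_ball, Complex.dist_eq, add_sub_cancel_left, norm_mul, Complex.norm_I, mul_one,
        Complex.norm_real, Real.norm_of_nonneg (by positivity)]
      linarith
    · simp
      linarith
  have hpr : (y + (s / 16 : ℝ) * Complex.I : ℂ) ∈ upperHalfDisc x₀ r :=
    upperHalfDisc_mono (by linarith) hp
  refine (hd.analyticOnNhd (isOpen_upperHalfDisc x₀ r)).eqOn_zero_of_preconnected_of_eventuallyEq_zero
    ?_ hpr ?_
  · exact ((convex_ball _ _).inter (convex_halfSpace_im_gt 0)).isPreconnected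
  · filter_upwards [(isOpen_upperHalfDisc y (s / 8)).mem_nhds hp] with w hw
    exact hz w (upperHalfDisc_subset_closed _ _ hw)

theorem exists_tendstoUniformlyOn_of_uniformCauchySeqOn {F : ℕ → ℂ → ℂ} {S : Set ℂ}
    (hF : UniformCauchySeqOn F atTop S) : ∃ f, TendstoUniformlyOn F f atTop S := by
  have h : ∀ z, ∃ w, z ∈ S → Tendsto (fun n => F n z) atTop (𝓝 w) := by
    intro z
    by_cases hz : z ∈ S
    · obtain ⟨w, hw⟩ := cauchySeq_tendsto_of_complete (hF.cauchySeq hz)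
      exact ⟨w, fun _ => hw⟩
    · exact ⟨0, fun h => absurd h hz⟩
  choose f hf using h
  exact ⟨f, hF.tendstoUniformlyOn_of_tendsto hf⟩

/-- A bounded sequence of holomorphic functions on a half disc that converges uniformly on the
diameter is uniformly Cauchy near the centre. -/
theorem uniformCauchySeqOn_of_diameter {F : ℕ → ℂ → ℂ} {x₀ r M : ℝ} (hr : 0 < r)
    (hc : ∀ n, ContinuousOn (F n) (closedUpperHalfDisc x₀ r))
    (hd : ∀ n, DifferentiableOn ℂ (F n) (upperHalfDisc x₀ r))
    (hM : ∀ n, ∀ z ∈ closedUpperHalfDisc x₀ r, ‖F n z‖ ≤ M)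
    (hu : UniformCauchySeqOn (fun n (x : ℝ) => F n x) atTop {x | |x - x₀| ≤ r}) :
    UniformCauchySeqOn F atTop (closedUpperHalfDisc x₀ (r / 8)) := by
  rw [Metric.uniformCauchySeqOn_iff] at hu ⊢
  intro η hη
  obtain ⟨ε, hε, H⟩ := exists_pos_norm_le_of_norm_le_on_diameter (M + M) hr (half_pos hη)
  obtain ⟨n₀, hn₀⟩ := hu ε hε
  refine ⟨n₀, fun m hm n hn z hz => ?_⟩
  rw [Complex.dist_eq]
  refine (H x₀ (F m - F n) ((hc m).sub (hc n)) ((hd m).sub (hd n)) (fun w hw => ?_)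
    (fun x hx => ?_) z hz).trans_lt (half_lt_self hη)
  · exact (norm_sub_le _ _).trans (add_le_add (hM m w hw) (hM n w hw))
  · rw [Pi.sub_apply, ← Complex.dist_eq]
    exact (hn₀ m hm n hn x hx).le

/-! ### The space `C^k` as a closed subspace of a product of Banach spaces -/

namespace CkSpace

variable {γ δ : ℝ} {h : γ < δ} {k : ℕ∞}

instance : IsTopologicalAddGroup (CkSpace h k) := (withSeminorms h k).topologicalAddGroup

instance : ContinuousSMul ℂ (CkSpace h k) := (withSeminorms h k).continuousSMul

theorem topology_eq_iInf_induced :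
    (inferInstance : TopologicalSpace (CkSpace h k)) =
      ⨅ l : {l : ℕ // (l : ℕ∞) ≤ k},
        TopologicalSpace.induced (derivMap h k l.1 l.2) inferInstance := by
  have h1 := withSeminorms_iInf
    (t := fun l : {l : ℕ // (l : ℕ∞) ≤ k} =>
      TopologicalSpace.induced (derivMap h k l.1 l.2) inferInstance)
    (p := fun l : {l : ℕ // (l : ℕ∞) ≤ k} =>
      SeminormFamily.comp (fun _ : Fin 1 => normSeminorm ℂ C(Icc γ δ, ℂ)) (derivMap h k l.1 l.2))
    fun l => (derivMap h k l.1 l.2).withSeminorms_induced (norm_withSeminorms ℂ C(Icc γ δ, ℂ))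
  -- The infimum topology comes with seminorms indexed by pairs of an order `l` and an element of
  -- `Fin 1`; the trivial second component is dropped.
  obtain ⟨h2⟩ := WithSeminorms.congr_equiv (t := _) h1 (Equiv.sigmaUnique _ _).symm
  exact (withSeminorms h k).topology_eq_withSeminorms.trans h2.symm

/-- The derivatives of order `l ≤ k`, jointly. -/
def jet (h : γ < δ) (k : ℕ∞) (u : CkSpace h k) :
    {l : ℕ // (l : ℕ∞) ≤ k} → C(Icc γ δ, ℂ) :=
  fun l => derivMap h k l.1 l.2 u

theorem isInducing_jet : IsInducing (jet h k) := by
  refine ⟨topology_eq_iInf_induced.trans ?_⟩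
  simp only [Pi.topologicalSpace, induced_iInf, induced_compose]
  rfl

theorem continuous_derivMap (l : ℕ) (hl : (l : ℕ∞) ≤ k) : Continuous (derivMap h k l hl) :=
  (continuous_apply (⟨l, hl⟩ : {l : ℕ // (l : ℕ∞) ≤ k})).comp isInducing_jet.continuous

theorem derivMap_zero_apply (u : CkSpace h k) (x : Icc γ δ) :
    derivMap h k 0 (by simp) u x = u x := by
  change iteratedDerivWithin 0 (extendZero u) (Icc γ δ) x = u x
  rw [iteratedDerivWithin_zero, extendZero_coe]

theorem ext {u v : CkSpace h k} (H : ∀ x, u x = v x) : u = v := Subtype.ext (funext H)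

theorem injective_jet : Function.Injective (jet h k) := by
  intro u v H
  refine ext fun x => ?_
  rw [← derivMap_zero_apply, ← derivMap_zero_apply]
  exact DFunLike.congr_fun (congrFun H ⟨0, by simp⟩) x

theorem hasDerivWithinAt_iteratedDerivWithin (u : CkSpace h k) {l : ℕ}
    (hl : ((l + 1 : ℕ) : ℕ∞) ≤ k) {x : ℝ} (hx : x ∈ Icc γ δ) :
    HasDerivWithinAt (iteratedDerivWithin l (extendZero u) (Icc γ δ))
      (iteratedDerivWithin (l + 1) (extendZero u) (Icc γ δ) x) (Icc γ δ) x := by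
  rw [iteratedDerivWithin_succ]
  refine DifferentiableWithinAt.hasDerivWithinAt ?_
  exact u.contDiffOn.differentiableOn_iteratedDerivWithin (m := l)
    (by exact_mod_cast (ENat.add_one_le_iff (ENat.natCast_ne_top l)).1 (by exact_mod_cast hl))
    (uniqueDiffOn_Icc h) x hx

/-- By the fundamental theorem of calculus, a family of continuous functions consists of the
successive derivatives of one function exactly when each is an integral of the next. Unlike
differentiability, the integral relation visibly passes to uniform limits, which makes the range
closed. -/
theorem range_jet : range (jet h k) = {v | ∀ (l : ℕ) (hl : ((l + 1 : ℕ) : ℕ∞) ≤ k)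
    (x : Icc γ δ), v ⟨l, le_trans (by exact_mod_cast Nat.le_succ l) hl⟩ x
      = v ⟨l, le_trans (by exact_mod_cast Nat.le_succ l) hl⟩ ⟨γ, left_mem_Icc.2 h.le⟩
        + ∫ t in γ..x, v ⟨l + 1, hl⟩ (projIcc γ δ h.le t)} := by
  ext v
  constructor
  · rintro ⟨u, rfl⟩ l hl x
    have hsub : Icc γ (x : ℝ) ⊆ Icc γ δ := Icc_subset_Icc_right x.2.2
    have h1 : ∫ t in γ..x, jet h k u ⟨l + 1, hl⟩ (projIcc γ δ h.le t)
        = iteratedDerivWithin l (extendZero u) (Icc γ δ) x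
          - iteratedDerivWithin l (extendZero u) (Icc γ δ) γ := by
      refine intervalIntegral.integral_eq_sub_of_hasDerivAt_of_le x.2.1
        (fun t ht => (hasDerivWithinAt_iteratedDerivWithin u hl (hsub ht)).continuousWithinAt.mono
          hsub) (fun t ht => ?_) ?_
      · have ht' : t ∈ Icc γ δ := hsub (Ioo_subset_Icc_self ht)
        rw [projIcc_of_mem h.le ht']
        exact (hasDerivWithinAt_iteratedDerivWithin u hl ht').hasDerivAt
          (Icc_mem_nhds ht.1 (ht.2.trans_le x.2.2))
      · exact ((jet h k u ⟨l + 1, hl⟩).continuous.comp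
          continuous_projIcc).intervalIntegrable _ _
    rw [h1]
    exact (add_sub_cancel _ _).symm
  · intro hv
    -- Extending each component by constants beyond the end points makes it continuous on all of
    -- `ℝ`, so its integral has an ordinary derivative everywhere.
    let w : ∀ l : ℕ, (l : ℕ∞) ≤ k → ℝ → ℂ := fun l hl t => v ⟨l, hl⟩ (projIcc γ δ h.le t)
    have hwc : ∀ l hl, Continuous (w l hl) := fun l hl =>
      (v ⟨l, hl⟩).continuous.comp continuous_projIcc
    have hw : ∀ (l : ℕ) (hl : ((l + 1 : ℕ) : ℕ∞) ≤ k), ∀ x ∈ Icc γ δ,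
        HasDerivWithinAt (w l (le_trans (by exact_mod_cast Nat.le_succ l) hl))
          (w (l + 1) hl x) (Icc γ δ) x := by
      intro l hl x hx
      have h1 : HasDerivAt (fun y => w l (le_trans (by exact_mod_cast Nat.le_succ l) hl) γ
          + ∫ t in γ..y, w (l + 1) hl t) (w (l + 1) hl x) x :=
        (((hwc (l + 1) hl).integral_hasStrictDerivAt γ x).hasDerivAt).const_add _
      refine h1.hasDerivWithinAt.congr_of_mem (fun y hy => ?_) hx
      simp only [w, projIcc_of_mem h.le hy, projIcc_left]
      exact hv l hl ⟨y, hy⟩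
    let f : Icc γ δ → ℂ := v ⟨0, by simp⟩
    have hf : ∀ (l : ℕ) (hl : (l : ℕ∞) ≤ k),
        EqOn (iteratedDerivWithin l (extendZero f) (Icc γ δ)) (w l hl) (Icc γ δ) := by
      intro l
      induction l with
      | zero =>
        intro hl x hx
        rw [iteratedDerivWithin_zero]
        simp only [w, projIcc_of_mem h.le hx]
        exact extendZero_coe f ⟨x, hx⟩
      | succ l ih =>
        intro hl x hx
        have hl' : (l : ℕ∞) ≤ k := le_trans (by exact_mod_cast Nat.le_succ l) hl
        rw [iteratedDerivWithin_succ, derivWithin_congr (ih hl') (ih hl' hx)]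
        exact (hw l hl x hx).derivWithin (uniqueDiffOn_Icc h x hx)
    have hcd : ContDiffOn ℝ k (extendZero f) (Icc γ δ) := by
      refine contDiffOn_of_continuousOn_differentiableOn_deriv
        (fun l hl => (hwc l hl).continuousOn.congr (hf l hl)) (fun l hl => ?_)
      have hl1 : ((l + 1 : ℕ) : ℕ∞) ≤ k := by exact_mod_cast Order.add_one_le_of_lt hl
      exact DifferentiableOn.congr (fun x hx => (hw l hl1 x hx).differentiableWithinAt)
        (hf l hl.le)
    refine ⟨(⟨f, hcd⟩ : ckSubmodule γ δ k), ?_⟩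
    funext l
    ext x
    refine (hf l.1 l.2 x.2).trans ?_
    simp only [w, projIcc_val]

theorem isClosedEmbedding_jet : IsClosedEmbedding (jet h k) := by
  refine ⟨⟨isInducing_jet, injective_jet⟩, ?_⟩
  rw [range_jet]
  simp only [ofPred_forall]
  refine isClosed_iInter fun l => isClosed_iInter fun hl => isClosed_iInter fun x =>
    isClosed_eq ?_ (.add ?_ ?_)
  · exact (ContinuousEvalConst.continuous_eval_const _).comp (continuous_apply _)
  · exact (ContinuousEvalConst.continuous_eval_const _).comp (continuous_apply _)
  · refine intervalIntegral.continuous_parametric_intervalIntegral_of_continuous' ?_ _ _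
    exact ((continuous_apply _).comp continuous_fst).eval
      (continuous_projIcc.comp continuous_snd)

/-- A closed subspace of a countable product of Banach spaces is completely metrizable. -/
instance : BaireSpace (CkSpace h k) :=
  have := (isClosedEmbedding_jet (h := h) (k := k)).IsCompletelyMetrizableSpace
  inferInstance

end CkSpace

/-! ### Extendable continuous functions and their uniform limits -/

section Extendable

variable {γ δ : ℝ}

/-- `ExtendsAbove` for continuous functions. -/
def ContinuousExtendsAbove (v : C(Icc γ δ, ℂ)) (x₀ r : ℝ) : Prop :=
  ∃ f : ℂ → ℂ, ContinuousOn f (segmentC γ δ ∪ upperHalfDisc x₀ r) ∧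
    DifferentiableOn ℂ f (upperHalfDisc x₀ r) ∧
    ∀ x : Icc γ δ, ((x : ℝ) : ℂ) ∈ ball (x₀ : ℂ) r → f ((x : ℝ) : ℂ) = v x

/-- `ExtendsToDisc` for continuous functions. -/
def ContinuousExtendsToDisc (v : C(Icc γ δ, ℂ)) (x₀ r : ℝ) : Prop :=
  ∃ f : ℂ → ℂ, DifferentiableOn ℂ f (ball (x₀ : ℂ) r) ∧
    ∀ x : Icc γ δ, ((x : ℝ) : ℂ) ∈ ball (x₀ : ℂ) r → f ((x : ℝ) : ℂ) = v x

/-- The functions with an extension that is continuous on a closed upper half disc and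
holomorphic inside. -/
def upperExtendable (γ δ x₀ r : ℝ) : Submodule ℂ C(Icc γ δ, ℂ) where
  carrier := {v | ∃ f : ℂ → ℂ, ContinuousOn f (closedUpperHalfDisc x₀ r) ∧
    DifferentiableOn ℂ f (upperHalfDisc x₀ r) ∧
    ∀ x : Icc γ δ, |(x : ℝ) - x₀| ≤ r → f ((x : ℝ) : ℂ) = v x}
  add_mem' := by
    rintro v w ⟨f, hfc, hfd, hf⟩ ⟨g, hgc, hgd, hg⟩
    refine ⟨f + g, hfc.add hgc, hfd.add hgd, fun x hx => ?_⟩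
    rw [Pi.add_apply, hf x hx, hg x hx, ContinuousMap.add_apply]
  zero_mem' := ⟨0, continuousOn_const, differentiableOn_const 0, fun _ _ => rfl⟩
  smul_mem' := by
    rintro c v ⟨f, hfc, hfd, hf⟩
    refine ⟨c • f, hfc.const_smul c, hfd.const_smul c, fun x hx => ?_⟩
    rw [Pi.smul_apply, hf x hx, ContinuousMap.smul_apply]

/-- The functions with an extension as in `upperExtendable` that is bounded by `M`. -/
def boundedUpperExtendable (γ δ x₀ r M : ℝ) : Set C(Icc γ δ, ℂ) :=
  {v | ∃ f : ℂ → ℂ, ContinuousOn f (closedUpperHalfDisc x₀ r) ∧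
    DifferentiableOn ℂ f (upperHalfDisc x₀ r) ∧
    (∀ z ∈ closedUpperHalfDisc x₀ r, ‖f z‖ ≤ M) ∧
    ∀ x : Icc γ δ, |(x : ℝ) - x₀| ≤ r → f ((x : ℝ) : ℂ) = v x}

/-- The functions with an extension that is bounded by `M` and continuous on a closed disc and
holomorphic inside. -/
def boundedDiscExtendable (γ δ x₀ r M : ℝ) : Set C(Icc γ δ, ℂ) :=
  {v | ∃ f : ℂ → ℂ, ContinuousOn f (closedBall (x₀ : ℂ) r) ∧
    DifferentiableOn ℂ f (ball (x₀ : ℂ) r) ∧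
    (∀ z ∈ closedBall (x₀ : ℂ) r, ‖f z‖ ≤ M) ∧
    ∀ x : Icc γ δ, |(x : ℝ) - x₀| ≤ r → f ((x : ℝ) : ℂ) = v x}

theorem mem_Icc_of_abs_sub_le {x x₀ r : ℝ} (h₁ : γ ≤ x₀ - r) (h₂ : x₀ + r ≤ δ)
    (hx : |x - x₀| ≤ r) : x ∈ Icc γ δ := by
  rw [abs_le] at hx
  constructor <;> linarith

theorem uniformCauchySeqOn_of_tendsto {v : ℕ → C(Icc γ δ, ℂ)} {w : C(Icc γ δ, ℂ)}
    (hv : Tendsto v atTop (𝓝 w)) {F : ℕ → ℂ → ℂ} {x₀ r : ℝ} (h₁ : γ ≤ x₀ - r) (h₂ : x₀ + r ≤ δ)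
    (hF : ∀ n, ∀ x : Icc γ δ, |(x : ℝ) - x₀| ≤ r → F n ((x : ℝ) : ℂ) = v n x) :
    UniformCauchySeqOn (fun n (x : ℝ) => F n x) atTop {x | |x - x₀| ≤ r} := by
  rw [Metric.uniformCauchySeqOn_iff]
  intro ε hε
  obtain ⟨N, hN⟩ := Metric.cauchySeq_iff.1 hv.cauchySeq ε hε
  refine ⟨N, fun m hm n hn x hx => ?_⟩
  have hxI := mem_Icc_of_abs_sub_le h₁ h₂ hx
  rw [hF m ⟨x, hxI⟩ hx, hF n ⟨x, hxI⟩ hx]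
  exact (ContinuousMap.dist_apply_le_dist _).trans_lt (hN m hm n hn)

theorem eq_of_tendstoUniformlyOn {v : ℕ → C(Icc γ δ, ℂ)} {w : C(Icc γ δ, ℂ)}
    (hv : Tendsto v atTop (𝓝 w)) {F : ℕ → ℂ → ℂ} {f : ℂ → ℂ} {S : Set ℂ}
    (hf : TendstoUniformlyOn F f atTop S) {x : Icc γ δ} (hx : ((x : ℝ) : ℂ) ∈ S)
    (hF : ∀ n, F n ((x : ℝ) : ℂ) = v n x) : f ((x : ℝ) : ℂ) = w x := by
  refine tendsto_nhds_unique (hf.tendsto_at hx) ?_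
  simp only [hF]
  exact ((ContinuousEvalConst.continuous_eval_const x).tendsto w).comp hv

/-- The common bound `M` and uniform convergence on the diameter make the extensions uniformly
Cauchy on the smaller half disc; their limit extends `w`. The diameter must lie in `L`, for
otherwise convergence in `C(L)` would not control the extensions on all of it. -/
theorem closure_boundedUpperExtendable_subset {x₀ r : ℝ} (M : ℝ) (hr : 0 < r) (h₁ : γ ≤ x₀ - r)
    (h₂ : x₀ + r ≤ δ) :
    closure (boundedUpperExtendable γ δ x₀ r M) ⊆ upperExtendable γ δ x₀ (r / 8) := by
  intro w hw
  obtain ⟨v, hvA, hv⟩ := mem_closure_iff_seq_limit.1 hw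
  choose F hFc hFd hFM hF using hvA
  obtain ⟨f, hf⟩ := exists_tendstoUniformlyOn_of_uniformCauchySeqOn
    (uniformCauchySeqOn_of_diameter hr hFc hFd hFM (uniformCauchySeqOn_of_tendsto hv h₁ h₂ hF))
  have hs : |x₀ - x₀| + r / 8 ≤ r := by rw [sub_self, abs_zero]; linarith
  refine ⟨f, hf.continuousOn (Frequently.of_forall fun n =>
    (hFc n).mono (closedUpperHalfDisc_mono hs)), ?_, fun x hx => ?_⟩
  · exact (hf.mono (upperHalfDisc_subset_closed _ _)).tendstoLocallyUniformlyOn.differentiableOn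
      (Eventually.of_forall fun n => (hFd n).mono (upperHalfDisc_mono hs))
      (isOpen_upperHalfDisc _ _)
  · exact eq_of_tendstoUniformlyOn hv hf (ofReal_mem_closedUpperHalfDisc.2 hx)
      fun n => hF n x (hx.trans (by linarith))

theorem conj_mem_closedBall_iff {x₀ r : ℝ} {z : ℂ} :
    conj z ∈ closedBall (x₀ : ℂ) r ↔ z ∈ closedBall (x₀ : ℂ) r := by
  rw [mem_closedBall, mem_closedBall, ← Complex.dist_conj_conj, Complex.conj_conj,
    Complex.conj_ofReal]

theorem conj_mem_ball_iff {x₀ r : ℝ} {z : ℂ} :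
    conj z ∈ ball (x₀ : ℂ) r ↔ z ∈ ball (x₀ : ℂ) r := by
  rw [mem_ball, mem_ball, ← Complex.dist_conj_conj, Complex.conj_conj,
    Complex.conj_ofReal]

theorem conj_mem_upperHalfDisc_iff {x₀ r : ℝ} {z : ℂ} :
    conj z ∈ upperHalfDisc x₀ r ↔ z ∈ lowerHalfDisc x₀ r :=
  and_congr conj_mem_ball_iff (by simp)

theorem conj_mem_lowerHalfDisc_iff {x₀ r : ℝ} {z : ℂ} :
    conj z ∈ lowerHalfDisc x₀ r ↔ z ∈ upperHalfDisc x₀ r :=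
  and_congr conj_mem_ball_iff (by simp)

theorem DifferentiableOn.conj_comp_conj {f : ℂ → ℂ} {s t : Set ℂ} (hf : DifferentiableOn ℂ f s)
    (hs : IsOpen s) (hst : ∀ z ∈ t, conj z ∈ s) :
    DifferentiableOn ℂ (fun z => conj (f (conj z))) t := by
  intro z hz
  have h : DifferentiableAt ℂ f (conj z) := hf.differentiableAt (hs.mem_nhds (hst z hz))
  have h' := h.conj_conj
  rw [Complex.conj_conj] at h'
  exact h'.differentiableWithinAt

theorem ContinuousOn.conj_comp_conj {f : ℂ → ℂ} {s t : Set ℂ} (hf : ContinuousOn f s)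
    (hst : ∀ z ∈ t, conj z ∈ s) :
    ContinuousOn (fun z => conj (f (conj z))) t :=
  Complex.continuous_conj.comp_continuousOn (hf.comp Complex.continuous_conj.continuousOn hst)

/-- A bounded sequence of holomorphic functions on a disc that converges uniformly on the
diameter is uniformly Cauchy near the centre. -/
theorem uniformCauchySeqOn_closedBall_of_diameter {F : ℕ → ℂ → ℂ} {x₀ r M : ℝ} (hr : 0 < r)
    (hc : ∀ n, ContinuousOn (F n) (closedBall (x₀ : ℂ) r))
    (hd : ∀ n, DifferentiableOn ℂ (F n) (ball (x₀ : ℂ) r))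
    (hM : ∀ n, ∀ z ∈ closedBall (x₀ : ℂ) r, ‖F n z‖ ≤ M)
    (hu : UniformCauchySeqOn (fun n (x : ℝ) => F n x) atTop {x | |x - x₀| ≤ r}) :
    UniformCauchySeqOn F atTop (closedBall (x₀ : ℂ) (r / 8)) := by
  have hup := uniformCauchySeqOn_of_diameter hr (fun n => (hc n).mono inter_subset_left)
    (fun n => (hd n).mono inter_subset_left) (fun n z hz => hM n z hz.1) hu
  -- The lower half disc is reflected to the upper one by `z ↦ conj (F n (conj z))`, which is again
  -- holomorphic and has the conjugate values on the diameter.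
  have hlow := uniformCauchySeqOn_of_diameter (F := fun n z => conj (F n (conj z))) (x₀ := x₀)
    (M := M) hr
    (fun n => (hc n).conj_comp_conj fun z hz => conj_mem_closedBall_iff.2 hz.1)
    (fun n => (hd n).conj_comp_conj isOpen_ball fun z hz => conj_mem_ball_iff.2 hz.1)
    (fun n z hz => by
      rw [RCLike.norm_conj]
      exact hM n _ (conj_mem_closedBall_iff.2 hz.1))
    (by
      simpa only [Metric.uniformCauchySeqOn_iff, Complex.conj_ofReal, Complex.dist_conj_conj]
        using hu)
  rw [Metric.uniformCauchySeqOn_iff] at hup hlow ⊢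
  intro ε hε
  obtain ⟨N₁, hN₁⟩ := hup ε hε
  obtain ⟨N₂, hN₂⟩ := hlow ε hε
  refine ⟨max N₁ N₂, fun m hm n hn z hz => ?_⟩
  rcases le_total 0 z.im with h | h
  · exact hN₁ m (le_of_max_le_left hm) n (le_of_max_le_left hn) z ⟨hz, h⟩
  · have := hN₂ m (le_of_max_le_right hm) n (le_of_max_le_right hn) (conj z)
      ⟨conj_mem_closedBall_iff.2 hz, by simpa using h⟩
    simpa only [Complex.conj_conj, Complex.dist_conj_conj] using this

theorem closure_boundedDiscExtendable_subset {x₀ r : ℝ} (M : ℝ) (hr : 0 < r) (h₁ : γ ≤ x₀ - r)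
    (h₂ : x₀ + r ≤ δ) :
    closure (boundedDiscExtendable γ δ x₀ r M) ⊆ {v | ContinuousExtendsToDisc v x₀ (r / 8)} := by
  intro w hw
  obtain ⟨v, hvA, hv⟩ := mem_closure_iff_seq_limit.1 hw
  choose F hFc hFd hFM hF using hvA
  obtain ⟨f, hf⟩ := exists_tendstoUniformlyOn_of_uniformCauchySeqOn
    (uniformCauchySeqOn_closedBall_of_diameter hr hFc hFd hFM
      (uniformCauchySeqOn_of_tendsto hv h₁ h₂ hF))
  refine ⟨f, ?_, fun x hx => ?_⟩
  · exact (hf.mono ball_subset_closedBall).tendstoLocallyUniformlyOn.differentiableOn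
      (Eventually.of_forall fun n => (hFd n).mono (ball_subset_ball (by linarith))) isOpen_ball
  · exact eq_of_tendstoUniformlyOn hv hf (ball_subset_closedBall hx)
      fun n => hF n x ((ofReal_mem_ball.1 hx).le.trans (by linarith))

/-! ### Countable decomposition of the extendable functions -/

/-- Every interval centred at a point of `[γ, δ]` contains a rational interval in `[γ, δ]`. -/
theorem exists_rat_subinterval (h : γ < δ) {y s : ℝ} (hy : y ∈ Icc γ δ) (hs : 0 < s) :
    ∃ p q : ℚ, (0 : ℝ) < q ∧ γ ≤ p - q ∧ p + q ≤ δ ∧ |(p : ℝ) - y| + q < s := by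
  have hab : max γ (y - s) < min δ (y + s) :=
    max_lt (lt_min h (by linarith [hy.1])) (lt_min (by linarith [hy.2]) (by linarith))
  obtain ⟨a, ha1, ha2⟩ := exists_rat_btwn hab
  obtain ⟨b, hb1, hb2⟩ := exists_rat_btwn ha2
  rw [max_lt_iff] at ha1
  rw [lt_min_iff] at hb2
  refine ⟨(a + b) / 2, (b - a) / 2, ?_, ?_, ?_, ?_⟩ <;> push_cast
  · linarith
  · linarith
  · linarith
  · rw [← lt_sub_iff_add_lt, abs_lt]
    constructor <;> linarith

/-- The given extension is continuous at real points only along `L` and from the half disc.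
Shrinking to a half disc with its diameter in `L` gives continuity on the whole closed half disc. -/
theorem ContinuousExtendsAbove.mem_upperExtendable {v : C(Icc γ δ, ℂ)} {y s x₀ r : ℝ}
    (hv : ContinuousExtendsAbove v y s) (h₁ : γ ≤ x₀ - r) (h₂ : x₀ + r ≤ δ)
    (hsub : |x₀ - y| + r < s) : v ∈ upperExtendable γ δ x₀ r := by
  obtain ⟨f, hfc, hfd, hf⟩ := hv
  have hball : closedBall (x₀ : ℂ) r ⊆ ball (y : ℂ) s := by
    refine closedBall_subset_ball' ?_
    rw [Complex.dist_of_im_eq (by simp), Complex.ofReal_re, Complex.ofReal_re, Real.dist_eq]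
    linarith
  refine ⟨f, hfc.mono fun z hz => ?_, hfd.mono (upperHalfDisc_mono hsub.le), fun x hx => ?_⟩
  · rcases (show (0 : ℝ) ≤ z.im from hz.2).eq_or_lt with h0 | h0
    · have hzx : (z.re : ℂ) = z := Complex.ext rfl h0
      refine Or.inl ⟨z.re, mem_Icc_of_abs_sub_le h₁ h₂ (ofReal_mem_closedBall.1 ?_), hzx⟩
      rw [hzx]
      exact hz.1
    · exact Or.inr ⟨hball hz.1, h0⟩
  · exact hf x (hball (ofReal_mem_closedBall.2 hx))

theorem isClosed_segmentC (γ δ : ℝ) : IsClosed (segmentC γ δ) :=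
  (isCompact_Icc.image Complex.continuous_ofReal).isClosed

theorem continuousExtendsAbove_of_mem_upperExtendable {v : C(Icc γ δ, ℂ)} {x₀ r : ℝ}
    (h : γ ≤ δ) (hv : v ∈ upperExtendable γ δ x₀ r) : ContinuousExtendsAbove v x₀ r := by
  classical
  obtain ⟨f, hfc, hfd, hf⟩ := hv
  -- `f` says nothing about the part of `L` outside the disc, so `v` is glued in. Both pieces are
  -- continuous on closed sets and agree on the overlap.
  set F : ℂ → ℂ := (segmentC γ δ).piecewise (fun z => v (projIcc γ δ h z.re)) f with hF
  have hFv : ∀ x : Icc γ δ, F ((x : ℝ) : ℂ) = v x := by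
    intro x
    have hx : ((x : ℝ) : ℂ) ∈ segmentC γ δ := ⟨x, x.2, rfl⟩
    rw [hF, piecewise_eq_of_mem _ _ _ hx, Complex.ofReal_re, projIcc_val]
  have hFf : EqOn F f (closedUpperHalfDisc x₀ r) := by
    intro z hz
    by_cases hzs : z ∈ segmentC γ δ
    · obtain ⟨x, hx, rfl⟩ := hzs
      rw [hFv ⟨x, hx⟩, hf ⟨x, hx⟩ (ofReal_mem_closedUpperHalfDisc.1 hz)]
    · exact piecewise_eq_of_notMem _ _ _ hzs
  have hFc : ContinuousOn F (segmentC γ δ ∪ closedUpperHalfDisc x₀ r) := by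
    refine ContinuousOn.union_of_isClosed ?_ (hfc.congr hFf) (isClosed_segmentC γ δ)
      (isClosed_closedUpperHalfDisc x₀ r)
    refine ContinuousOn.congr (Continuous.continuousOn ?_) (piecewise_eqOn _ _ _)
    exact v.continuous.comp (continuous_projIcc.comp Complex.continuous_re)
  exact ⟨F, hFc.mono (union_subset_union_right _ (upperHalfDisc_subset_closed _ _)),
    hfd.congr fun z hz => hFf (upperHalfDisc_subset_closed _ _ hz), fun x _ => hFv x⟩

theorem ContinuousExtendsToDisc.continuousExtendsAbove {v : C(Icc γ δ, ℂ)} {x₀ r s : ℝ}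
    (h : γ ≤ δ) (hv : ContinuousExtendsToDisc v x₀ s) (hrs : r < s) :
    ContinuousExtendsAbove v x₀ r := by
  obtain ⟨f, hfd, hf⟩ := hv
  have hsub := closedBall_subset_ball (x := (x₀ : ℂ)) hrs
  exact continuousExtendsAbove_of_mem_upperExtendable h
    ⟨f, hfd.continuousOn.mono (inter_subset_left.trans hsub),
      hfd.mono (inter_subset_left.trans (ball_subset_ball hrs.le)),
      fun x hx => hf x (hsub (ofReal_mem_closedBall.2 hx))⟩

theorem ContinuousExtendsToDisc.exists_mem_boundedDiscExtendable {v : C(Icc γ δ, ℂ)}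
    {y s x₀ r : ℝ} (hv : ContinuousExtendsToDisc v y s) (hsub : |x₀ - y| + r < s) :
    ∃ M : ℕ, v ∈ boundedDiscExtendable γ δ x₀ r M := by
  obtain ⟨f, hfd, hf⟩ := hv
  have hball : closedBall (x₀ : ℂ) r ⊆ ball (y : ℂ) s := by
    refine closedBall_subset_ball' ?_
    rw [Complex.dist_of_im_eq (by simp), Complex.ofReal_re, Complex.ofReal_re, Real.dist_eq]
    linarith
  have hfc := hfd.continuousOn.mono hball
  obtain ⟨M, hM⟩ := (isCompact_closedBall (x₀ : ℂ) r).exists_bound_of_continuousOn hfc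
  exact ⟨⌈M⌉₊, f, hfc, hfd.mono (ball_subset_closedBall.trans hball),
    fun z hz => (hM z hz).trans (Nat.le_ceil M), fun x hx => hf x (hball
      (ofReal_mem_closedBall.2 hx))⟩

theorem exists_mem_boundedUpperExtendable {v : C(Icc γ δ, ℂ)} {x₀ r : ℝ}
    (hv : v ∈ upperExtendable γ δ x₀ r) :
    ∃ M : ℕ, v ∈ boundedUpperExtendable γ δ x₀ r M := by
  obtain ⟨f, hfc, hfd, hf⟩ := hv
  obtain ⟨M, hM⟩ := (isCompact_closedUpperHalfDisc x₀ r).exists_bound_of_continuousOn hfc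
  exact ⟨⌈M⌉₊, f, hfc, hfd, fun z hz => (hM z hz).trans (Nat.le_ceil M), hf⟩

theorem boundedUpperExtendable_subset (x₀ r M : ℝ) :
    boundedUpperExtendable γ δ x₀ r M ⊆ upperExtendable γ δ x₀ r :=
  fun _ ⟨f, hfc, hfd, _, hf⟩ => ⟨f, hfc, hfd, hf⟩

theorem boundedDiscExtendable_subset (x₀ r M : ℝ) :
    boundedDiscExtendable γ δ x₀ r M ⊆ {v | ContinuousExtendsToDisc v x₀ r} :=
  fun _ ⟨f, _, hfd, _, hf⟩ =>
    ⟨f, hfd, fun x hx => hf x (ofReal_mem_ball.1 hx).le⟩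

/-- The centres and radii of the rational intervals in `[γ, δ]`, with a bound. -/
def DiscIndex (γ δ : ℝ) : Type :=
  {j : ℚ × ℚ // (0 : ℝ) < j.2 ∧ γ ≤ j.1 - j.2 ∧ j.1 + j.2 ≤ δ} × ℕ

instance : Countable (DiscIndex γ δ) := by
  unfold DiscIndex
  infer_instance

theorem center_mem_Icc {x₀ r : ℝ} (hr : 0 < r) (h₁ : γ ≤ x₀ - r) (h₂ : x₀ + r ≤ δ) :
    x₀ ∈ Icc γ δ := ⟨by linarith, by linarith⟩

theorem setOf_continuousExtendsAbove (h : γ < δ) :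
    {v : C(Icc γ δ, ℂ) | ∃ x₀ ∈ Icc γ δ, ∃ r > 0, ContinuousExtendsAbove v x₀ r}
      = ⋃ j : DiscIndex γ δ, boundedUpperExtendable γ δ j.1.1.1 j.1.1.2 j.2 := by
  ext v
  rw [mem_iUnion]
  constructor
  · rintro ⟨y, hy, s, hs, hv⟩
    obtain ⟨p, q, hq, h₁, h₂, hsub⟩ := exists_rat_subinterval h hy hs
    obtain ⟨M, hM⟩ := exists_mem_boundedUpperExtendable (hv.mem_upperExtendable h₁ h₂ hsub)
    exact ⟨⟨⟨(p, q), hq, h₁, h₂⟩, M⟩, hM⟩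
  · rintro ⟨⟨⟨⟨p, q⟩, hq, h₁, h₂⟩, M⟩, hv⟩
    exact ⟨p, center_mem_Icc hq h₁ h₂, q, hq, continuousExtendsAbove_of_mem_upperExtendable h.le
      (boundedUpperExtendable_subset _ _ _ hv)⟩

theorem setOf_continuousExtendsToDisc (h : γ < δ) :
    {v : C(Icc γ δ, ℂ) | ∃ x₀ ∈ Icc γ δ, ∃ r > 0, ContinuousExtendsToDisc v x₀ r}
      = ⋃ j : DiscIndex γ δ, boundedDiscExtendable γ δ j.1.1.1 j.1.1.2 j.2 := by
  ext v
  rw [mem_iUnion]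
  constructor
  · rintro ⟨y, hy, s, hs, hv⟩
    obtain ⟨p, q, hq, h₁, h₂, hsub⟩ := exists_rat_subinterval h hy hs
    obtain ⟨M, hM⟩ := hv.exists_mem_boundedDiscExtendable hsub
    exact ⟨⟨⟨(p, q), hq, h₁, h₂⟩, M⟩, hM⟩
  · rintro ⟨⟨⟨⟨p, q⟩, hq, h₁, h₂⟩, M⟩, hv⟩
    exact ⟨p, center_mem_Icc hq h₁ h₂, q, hq, boundedDiscExtendable_subset _ _ _ hv⟩

/-- The closure of one `A i` may spill into other members of the family. This is the form needed
here, since passing to a limit shrinks the radius and changes the bound. -/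
theorem isGδ_compl_iUnion_of_closure_subset {X ι : Type*} [TopologicalSpace X] [Countable ι]
    {A : ι → Set X} (hA : ∀ i, closure (A i) ⊆ ⋃ j, A j) : IsGδ (⋃ i, A i)ᶜ := by
  have h : ⋃ i, A i = ⋃ i, closure (A i) :=
    (iUnion_mono fun _ => subset_closure).antisymm (iUnion_subset hA)
  rw [h, compl_iUnion]
  exact .iInter_of_isOpen fun _ => isClosed_closure.isOpen_compl

theorem isGδ_not_continuousExtendsAbove (h : γ < δ) :
    IsGδ {v : C(Icc γ δ, ℂ) | ¬ ∃ x₀ ∈ Icc γ δ, ∃ r > 0, ContinuousExtendsAbove v x₀ r} := by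
  rw [← compl_ofPred, setOf_continuousExtendsAbove h]
  refine isGδ_compl_iUnion_of_closure_subset ?_
  rintro ⟨⟨⟨p, q⟩, hq, h₁, h₂⟩, M⟩ v hv
  rw [← setOf_continuousExtendsAbove h]
  exact ⟨p, center_mem_Icc hq h₁ h₂, q / 8, by positivity,
    continuousExtendsAbove_of_mem_upperExtendable h.le
      (closure_boundedUpperExtendable_subset _ hq h₁ h₂ hv)⟩

theorem isGδ_not_continuousExtendsToDisc (h : γ < δ) :
    IsGδ {v : C(Icc γ δ, ℂ) | ¬ ∃ x₀ ∈ Icc γ δ, ∃ r > 0, ContinuousExtendsToDisc v x₀ r} := by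
  rw [← compl_ofPred, setOf_continuousExtendsToDisc h]
  refine isGδ_compl_iUnion_of_closure_subset ?_
  rintro ⟨⟨⟨p, q⟩, hq, h₁, h₂⟩, M⟩ v hv
  rw [← setOf_continuousExtendsToDisc h]
  exact ⟨p, center_mem_Icc hq h₁ h₂, q / 8, by positivity,
    closure_boundedDiscExtendable_subset _ hq h₁ h₂ hv⟩

/-- A function that vanishes to the left of `x₀` but not to the right has no extension. -/
theorem notMem_upperExtendable {v : C(Icc γ δ, ℂ)} {x₀ r : ℝ} (hr : 0 < r) (h₁ : γ ≤ x₀ - r)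
    (h₂ : x₀ + r ≤ δ) (hleft : ∀ x : Icc γ δ, (x : ℝ) ≤ x₀ → v x = 0)
    (hright : ∀ x : Icc γ δ, x₀ < (x : ℝ) → v x ≠ 0) : v ∉ upperExtendable γ δ x₀ r := by
  rintro ⟨f, hfc, hfd, hf⟩
  -- The interval of centre `x₀ - r / 2` and radius `r / 2` is the left half of the diameter, where
  -- `v` vanishes; so `f` vanishes on the whole half disc.
  have hs : |x₀ - r / 2 - x₀| + r / 2 ≤ r := by
    rw [sub_sub_cancel_left, abs_neg, abs_of_pos (by positivity)]
    linarith
  have h0 : EqOn f 0 (upperHalfDisc x₀ r) := by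
    refine eqOn_zero_of_eq_zero_on_diameter (half_pos hr) hs hfc hfd fun x hx => ?_
    rw [abs_le] at hx
    have hx' : |x - x₀| ≤ r := abs_le.2 ⟨by linarith, by linarith⟩
    rw [hf ⟨x, mem_Icc_of_abs_sub_le h₁ h₂ hx'⟩ hx']
    exact hleft _ (by simp only; linarith)
  have hx' : |x₀ + r / 2 - x₀| ≤ r := abs_le.2 ⟨by linarith, by linarith⟩
  have hxI := mem_Icc_of_abs_sub_le h₁ h₂ hx'
  have hxK : ((x₀ + r / 2 : ℝ) : ℂ) ∈ closedUpperHalfDisc x₀ r :=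
    ofReal_mem_closedUpperHalfDisc.2 hx'
  refine hright ⟨x₀ + r / 2, hxI⟩ (by simp only; linarith) ?_
  rw [← hf ⟨x₀ + r / 2, hxI⟩ hx']
  -- The point `x₀ + r / 2` is a vertical limit of points of the half disc, so continuity forces `f`
  -- to vanish there, against `hright`.
  have hx : ((x₀ + r / 2 : ℝ) : ℂ) ∈ closure (upperHalfDisc x₀ r) := by
    have hray : Tendsto (fun t : ℝ => ((x₀ + r / 2 : ℝ) : ℂ) + t * Complex.I) (𝓝[>] 0)
        (𝓝 ((x₀ + r / 2 : ℝ) : ℂ)) := by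
      have hcont : Continuous fun t : ℝ => ((x₀ + r / 2 : ℝ) : ℂ) + t * Complex.I := by fun_prop
      have := hcont.tendsto 0
      simp only [Complex.ofReal_zero, zero_mul, add_zero] at this
      exact this.mono_left nhdsWithin_le_nhds
    refine mem_closure_of_tendsto hray ?_
    have hb : ball (x₀ : ℂ) r ∈ 𝓝 ((x₀ + r / 2 : ℝ) : ℂ) :=
      isOpen_ball.mem_nhds (ofReal_mem_ball.2 (by
        rw [add_sub_cancel_left, abs_of_pos (by positivity)]
        linarith))
    filter_upwards [hray hb, self_mem_nhdsWithin] with t ht ht0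
    exact ⟨ht, by simpa using ht0⟩
  have hcl : closure (upperHalfDisc x₀ r) ⊆ closedUpperHalfDisc x₀ r :=
    closure_minimal (upperHalfDisc_subset_closed x₀ r) (isClosed_closedUpperHalfDisc x₀ r)
  exact h0.of_subset_closure (hfc.mono hcl) continuousOn_const subset_closure le_rfl hx

end Extendable

/-! ### Transfer to `C^k`: the `Gδ` property and density -/

namespace CkSpace

variable {γ δ : ℝ} {h : γ < δ} {k : ℕ∞}

/-- The embedding of `C^k([γ, δ])` into the continuous functions. -/
def toContinuousMap (h : γ < δ) (k : ℕ∞) : CkSpace h k →ₗ[ℂ] C(Icc γ δ, ℂ) :=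
  derivMap h k 0 (by simp)

theorem toContinuousMap_apply (u : CkSpace h k) (x : Icc γ δ) : toContinuousMap h k u x = u x :=
  derivMap_zero_apply u x

theorem continuous_toContinuousMap : Continuous (toContinuousMap h k) :=
  continuous_derivMap 0 _

/-- The complex conjugate of an element of `C^k([γ, δ])`, as a continuous function. -/
def conjToContinuousMap (h : γ < δ) (k : ℕ∞) : CkSpace h k →ₛₗ[starRingEnd ℂ] C(Icc γ δ, ℂ) :=
  ((starₗᵢ ℂ : C(Icc γ δ, ℂ) ≃ₗᵢ⋆[ℂ] C(Icc γ δ, ℂ)).toLinearEquiv :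
    C(Icc γ δ, ℂ) →ₛₗ[starRingEnd ℂ] C(Icc γ δ, ℂ)).comp (toContinuousMap h k)

theorem conjToContinuousMap_apply (u : CkSpace h k) (x : Icc γ δ) :
    conjToContinuousMap h k u x = conj (u x) :=
  congrArg conj (toContinuousMap_apply u x)

theorem continuous_conjToContinuousMap : Continuous (conjToContinuousMap h k) :=
  (starₗᵢ ℂ : C(Icc γ δ, ℂ) ≃ₗᵢ⋆[ℂ] C(Icc γ δ, ℂ)).continuous.comp continuous_toContinuousMap

theorem extendsAbove_iff {u : CkSpace h k} {x₀ r : ℝ} :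
    ExtendsAbove u x₀ r ↔ ContinuousExtendsAbove (toContinuousMap h k u) x₀ r := by
  simp only [ExtendsAbove, ContinuousExtendsAbove, toContinuousMap_apply]

theorem extendsToDisc_iff {u : CkSpace h k} {x₀ r : ℝ} :
    ExtendsToDisc u x₀ r ↔ ContinuousExtendsToDisc (toContinuousMap h k u) x₀ r := by
  simp only [ExtendsToDisc, ContinuousExtendsToDisc, toContinuousMap_apply]

theorem conj_mem_segmentC {z : ℂ} (hz : z ∈ segmentC γ δ) : conj z ∈ segmentC γ δ := by
  obtain ⟨x, hx, rfl⟩ := hz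
  exact ⟨x, hx, (Complex.conj_ofReal x).symm⟩

theorem isOpen_lowerHalfDisc (x₀ r : ℝ) : IsOpen (lowerHalfDisc x₀ r) :=
  isOpen_ball.inter (isOpen_lt Complex.continuous_im continuous_const)

/-- The reflection `f ↦ conj ∘ f ∘ conj` exchanges the half discs and conjugates the boundary
values. -/
theorem extendsBelow_iff {u : CkSpace h k} {x₀ r : ℝ} :
    ExtendsBelow u x₀ r ↔ ContinuousExtendsAbove (conjToContinuousMap h k u) x₀ r := by
  simp only [ExtendsBelow, ContinuousExtendsAbove, conjToContinuousMap_apply]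
  constructor
  · rintro ⟨f, hfc, hfd, hf⟩
    refine ⟨fun z => conj (f (conj z)), hfc.conj_comp_conj fun z hz => ?_,
      hfd.conj_comp_conj (isOpen_lowerHalfDisc x₀ r) fun z => conj_mem_lowerHalfDisc_iff.2,
      fun x hx => ?_⟩
    · exact hz.imp conj_mem_segmentC conj_mem_lowerHalfDisc_iff.2
    · simp only [Complex.conj_ofReal]
      rw [hf x hx]
  · rintro ⟨f, hfc, hfd, hf⟩
    refine ⟨fun z => conj (f (conj z)), hfc.conj_comp_conj fun z hz => ?_,
      hfd.conj_comp_conj (isOpen_upperHalfDisc x₀ r) fun z => conj_mem_upperHalfDisc_iff.2,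
      fun x hx => ?_⟩
    · exact hz.imp conj_mem_segmentC conj_mem_upperHalfDisc_iff.2
    · simp only [Complex.conj_ofReal]
      rw [hf x hx, Complex.conj_conj]

/-- The smooth function `exp (-1 / (x - x₀))` for `x > x₀`, `0` for `x ≤ x₀`. -/
def flat (h : γ < δ) (k : ℕ∞) (x₀ : ℝ) : CkSpace h k :=
  (⟨fun x => (expNegInvGlue (x - x₀) : ℂ), by
    have h1 : ContDiff ℝ k fun x : ℝ => (expNegInvGlue (x - x₀) : ℂ) :=
      Complex.ofRealCLM.contDiff.comp
        (expNegInvGlue.contDiff.comp (contDiff_id.sub contDiff_const))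
    exact h1.contDiffOn.congr fun x hx => extendZero_coe _ ⟨x, hx⟩⟩ : ckSubmodule γ δ k)

theorem flat_apply (x₀ : ℝ) (x : Icc γ δ) : flat h k x₀ x = (expNegInvGlue (x - x₀) : ℂ) := rfl

/-- `W i` need not be closed, and `closure (A i)` need not be linear. The closed set suits Baire's
theorem, and the linear one, being proper in the preimage, shows that its interior is empty.
Semilinearity of `φ` admits conjugation as well as the inclusion. -/
theorem dense_preimage_of_closure_subset {σ : ℂ →+* ℂ} {V ι : Type*} [AddCommGroup V] [Module ℂ V]
    [TopologicalSpace V] [Countable ι] {φ : CkSpace h k →ₛₗ[σ] V} (hφ : Continuous φ)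
    {A : ι → Set V} {W : ι → Submodule ℂ V} (hA : ∀ i, closure (A i) ⊆ W i)
    (hW : ∀ i, ∃ u, φ u ∉ W i) : Dense (φ ⁻¹' (⋃ i, A i)ᶜ) := by
  have h1 : Dense (⋂ i, (φ ⁻¹' closure (A i))ᶜ) := by
    refine dense_iInter_of_isOpen (fun i => (isClosed_closure.preimage hφ).isOpen_compl)
      fun i => ?_
    rw [← interior_eq_empty_iff_dense_compl]
    by_contra hne
    have htop := ((W i).comap φ).eq_top_of_nonempty_interior'
      ((nonempty_iff_ne_empty.2 hne).mono
        (interior_mono (preimage_mono (f := φ) (hA i) : _ ⊆ φ ⁻¹' W i)))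
    obtain ⟨u, hu⟩ := hW i
    exact hu (htop ▸ Submodule.mem_top : u ∈ (W i).comap φ)
  refine h1.mono ?_
  rw [← compl_iUnion, preimage_compl, compl_subset_compl, preimage_iUnion]
  exact iUnion_mono fun i => preimage_mono subset_closure

theorem dense_preimage_not_continuousExtendsAbove {σ : ℂ →+* ℂ}
    {φ : CkSpace h k →ₛₗ[σ] C(Icc γ δ, ℂ)} (hφ : Continuous φ)
    (hflat : ∀ x₀ x, φ (flat h k x₀) x = (expNegInvGlue (x - x₀) : ℂ)) :
    Dense (φ ⁻¹' {v | ¬ ∃ x₀ ∈ Icc γ δ, ∃ r > 0, ContinuousExtendsAbove v x₀ r}) := by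
  rw [← compl_ofPred, setOf_continuousExtendsAbove h]
  refine dense_preimage_of_closure_subset hφ
    (W := fun j : DiscIndex γ δ => upperExtendable γ δ j.1.1.1 (j.1.1.2 / 8)) ?_ ?_
  · rintro ⟨⟨⟨p, q⟩, hq, h₁, h₂⟩, M⟩
    exact closure_boundedUpperExtendable_subset _ hq h₁ h₂
  · rintro ⟨⟨⟨p, q⟩, hq, h₁, h₂⟩, M⟩
    simp only at hq h₁ h₂
    refine ⟨flat h k p, notMem_upperExtendable (by positivity) (by simp only; linarith)
      (by simp only; linarith) (fun x hx => ?_) (fun x hx => ?_)⟩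
    · rw [hflat, expNegInvGlue.zero_of_nonpos (by simpa using hx), Complex.ofReal_zero]
    · rw [hflat, Complex.ofReal_ne_zero]
      exact (expNegInvGlue.pos_of_pos (by simpa using hx)).ne'

theorem classU2_eq_preimage : classU2 h k = toContinuousMap h k ⁻¹'
    {v | ¬ ∃ x₀ ∈ Icc γ δ, ∃ r > 0, ContinuousExtendsAbove v x₀ r} := by
  simp only [classU2, extendsAbove_iff, preimage_ofPred_eq]

theorem classU3_eq_preimage : classU3 h k = conjToContinuousMap h k ⁻¹'
    {v | ¬ ∃ x₀ ∈ Icc γ δ, ∃ r > 0, ContinuousExtendsAbove v x₀ r} := by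
  simp only [classU3, extendsBelow_iff, preimage_ofPred_eq]

theorem classU5_eq_preimage : classU5 h k = toContinuousMap h k ⁻¹'
    {v | ¬ ∃ x₀ ∈ Icc γ δ, ∃ r > 0, ContinuousExtendsToDisc v x₀ r} := by
  simp only [classU5, extendsToDisc_iff, preimage_ofPred_eq]

theorem isGδ_classU2 : IsGδ (classU2 h k) := by
  rw [classU2_eq_preimage]
  exact (isGδ_not_continuousExtendsAbove h).preimage continuous_toContinuousMap

theorem isGδ_classU3 : IsGδ (classU3 h k) := by
  rw [classU3_eq_preimage]
  exact (isGδ_not_continuousExtendsAbove h).preimage continuous_conjToContinuousMap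

theorem isGδ_classU5 : IsGδ (classU5 h k) := by
  rw [classU5_eq_preimage]
  exact (isGδ_not_continuousExtendsToDisc h).preimage continuous_toContinuousMap

theorem dense_classU2 : Dense (classU2 h k) := by
  rw [classU2_eq_preimage]
  exact dense_preimage_not_continuousExtendsAbove continuous_toContinuousMap
    fun x₀ x => toContinuousMap_apply _ x

theorem dense_classU3 : Dense (classU3 h k) := by
  rw [classU3_eq_preimage]
  refine dense_preimage_not_continuousExtendsAbove continuous_conjToContinuousMap fun x₀ x => ?_
  rw [conjToContinuousMap_apply, flat_apply, Complex.conj_ofReal]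

theorem isGδ_classU4 : IsGδ (classU4 h k) := isGδ_classU2.inter isGδ_classU3

theorem dense_classU4 : Dense (classU4 h k) :=
  dense_classU2.inter_of_Gδ isGδ_classU2 isGδ_classU3 dense_classU3

/-- A holomorphic function on a disc is continuous up to the boundary of a smaller half disc, so it
provides an extension above. -/
theorem classU2_subset_classU5 : classU2 h k ⊆ classU5 h k := by
  rintro u hu ⟨x₀, hx₀, r, hr, hext⟩
  exact hu ⟨x₀, hx₀, r / 2, half_pos hr, extendsAbove_iff.2
    ((extendsToDisc_iff.1 hext).continuousExtendsAbove h.le (half_lt_self hr))⟩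

theorem dense_classU5 : Dense (classU5 h k) := dense_classU2.mono classU2_subset_classU5

/-! ### Real analyticity and extension to discs -/

/-- A real analytic function of a real variable extends to a holomorphic function. -/
theorem _root_.AnalyticAt.exists_holomorphic_extension {g : ℝ → ℂ} {x₀ : ℝ}
    (hg : AnalyticAt ℝ g x₀) : ∃ r > 0, ∃ f : ℂ → ℂ, DifferentiableOn ℂ f (ball (x₀ : ℂ) r) ∧
      ∀ x : ℝ, |x - x₀| < r → f x = g x := by
  obtain ⟨p, hp⟩ := hg
  rw [hasFPowerSeriesAt_iff', Metric.eventually_nhds_iff] at hp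
  obtain ⟨ε, hε, hp⟩ := hp
  -- Convergence at the single point `x₀ + ε / 2` bounds the terms there. On the disc of radius `ε /
  -- 4` the complex series is then dominated by a geometric series of ratio `1 / 2`.
  have hsum : Summable fun n => (ε / 2) ^ n • p.coeff n := by
    have := (hp (y := x₀ + ε / 2) (by
      rw [Real.dist_eq, add_sub_cancel_left, abs_of_pos (by positivity)]
      linarith)).summable
    simpa only [add_sub_cancel_left] using this
  obtain ⟨C, hC⟩ := (Metric.isBounded_range_of_tendsto _ hsum.tendsto_atTop_zero).exists_norm_le
  have hC' : ∀ n, (ε / 2) ^ n * ‖p.coeff n‖ ≤ C := by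
    intro n
    have := hC _ (mem_range_self n)
    rwa [norm_smul, norm_pow, Real.norm_of_nonneg (by positivity)] at this
  refine ⟨ε / 4, by positivity, fun z => ∑' n, (z - x₀) ^ n * p.coeff n, ?_, fun x hx => ?_⟩
  · refine Complex.differentiableOn_tsum_of_summable_norm (u := fun n => C * (1 / 2) ^ n)
      (summable_geometric_two.mul_left C) (fun n => ?_) isOpen_ball fun n z hz => ?_
    · exact Differentiable.differentiableOn (by fun_prop)
    · rw [mem_ball, Complex.dist_eq] at hz
      rw [norm_mul, norm_pow]
      calc ‖z - x₀‖ ^ n * ‖p.coeff n‖ ≤ (ε / 4) ^ n * ‖p.coeff n‖ := by gcongr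
        _ = ((ε / 2) ^ n * ‖p.coeff n‖) * (1 / 2) ^ n := by
          rw [mul_right_comm, ← mul_pow]
          ring_nf
        _ ≤ C * (1 / 2) ^ n := by
          gcongr
          exact hC' n
  · have h1 := hp (y := x) (by rw [Real.dist_eq]; linarith)
    rw [← h1.tsum_eq]
    refine tsum_congr fun n => ?_
    rw [Complex.real_smul]
    push_cast
    rfl

theorem analyticWithinAt_iff_extendsToDisc {u : CkSpace h k} {x₀ : ℝ} (hx₀ : x₀ ∈ Icc γ δ) :
    AnalyticWithinAt ℝ (extendZero u) (Icc γ δ) x₀ ↔ ∃ r > 0, ExtendsToDisc u x₀ r := by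
  constructor
  · intro hu
    obtain ⟨g, hug, hg⟩ := analyticWithinAt_iff_exists_analyticAt.1 hu
    rw [insert_eq_of_mem hx₀] at hug
    obtain ⟨ε, hε, hug⟩ := Metric.mem_nhdsWithin_iff.1 hug
    obtain ⟨r, hr, f, hfd, hf⟩ := hg.exists_holomorphic_extension
    -- Within `ε` of `x₀`, `u` agrees on `L` with the analytic `g`; within `r`, `g` agrees with the
    -- holomorphic `f`.
    refine ⟨min ε r, lt_min hε hr, f, hfd.mono (ball_subset_ball (min_le_right _ _)),
      fun x hx => ?_⟩
    rw [ofReal_mem_ball, lt_min_iff] at hx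
    rw [hf x hx.2, ← extendZero_coe u x]
    exact (hug ⟨by rw [mem_ball, Real.dist_eq]; exact hx.1, x.2⟩).symm
  · rintro ⟨r, hr, f, hfd, hf⟩
    have hfa : AnalyticAt ℂ f (x₀ : ℂ) :=
      hfd.analyticAt (isOpen_ball.mem_nhds (mem_ball_self hr))
    have hga : AnalyticAt ℝ (fun x : ℝ => f x) x₀ :=
      (hfa.restrictScalars (𝕜 := ℝ)).comp (f := fun x : ℝ => (x : ℂ))
        (Complex.ofRealCLM.analyticAt x₀)
    refine analyticWithinAt_iff_exists_analyticAt.2 ⟨_, ?_, hga⟩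
    rw [insert_eq_of_mem hx₀]
    filter_upwards [mem_nhdsWithin_of_mem_nhds (ball_mem_nhds x₀ hr), self_mem_nhdsWithin]
      with x hx hxI
    rw [hf ⟨x, hxI⟩ (ofReal_mem_ball.2 hx)]
    exact extendZero_coe u ⟨x, hxI⟩

theorem nowhereAnalytic_eq_classU5 : nowhereAnalytic h k = classU5 h k := by
  ext u
  simp only [nowhereAnalytic, classU5, mem_ofPred_eq]
  rw [not_exists]
  refine forall_congr' fun x₀ => ?_
  rw [not_and]
  exact forall_congr' fun hx₀ => not_congr (analyticWithinAt_iff_extendsToDisc hx₀)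

end CkSpace

end

theorem theorem4p13 :
    (∀ (γ δ : ℝ) (h : γ < δ) (k : ℕ∞),
      (Dense (classU2 h k) ∧ IsGδ (classU2 h k)) ∧
      (Dense (classU3 h k) ∧ IsGδ (classU3 h k)) ∧
      (Dense (classU4 h k) ∧ IsGδ (classU4 h k)) ∧
      (Dense (classU5 h k) ∧ IsGδ (classU5 h k))) ∧
    (Dense (nowhereAnalytic (zero_lt_one : (0 : ℝ) < 1) ⊤) ∧
      IsGδ (nowhereAnalytic (zero_lt_one : (0 : ℝ) < 1) ⊤)) := by
  refine ⟨fun γ δ h k => ⟨⟨CkSpace.dense_classU2, CkSpace.isGδ_classU2⟩,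
    ⟨CkSpace.dense_classU3, CkSpace.isGδ_classU3⟩, ⟨CkSpace.dense_classU4, CkSpace.isGδ_classU4⟩,
    ⟨CkSpace.dense_classU5, CkSpace.isGδ_classU5⟩⟩, ?_⟩
  rw [CkSpace.nowhereAnalytic_eq_classU5]
  exact ⟨CkSpace.dense_classU5, CkSpace.isGδ_classU5⟩
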